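/- Let $m\ge 1$ be an integer, $n=2m$, and let $\mathbb F_{3^m}\subset\mathbb F_{3^n}$ be finite fields with $3^m$ and $3^n$ elements. For $\delta\in\mathbb F_{3^n}$ put $F(X)=(X^{3^m}-X+\delta)^{3^{2m-1}+2\cdot 3^{m-1}}+X$, regarded as a function $\mathbb F_{3^n}\to\mathbb F_{3^n}$, and let $\mathrm{Tr}_m^{2m}(\delta)=\delta+\delta^{3^m}$. For $c\in\mathbb F_{3^n}$, the $c$-differential uniformity of $F$ is the maximum, over all $a,b\in\mathbb F_{3^n}$ (with $a\neq 0$ if $c=1$), of the number of $x\in\mathbb F_{3^n}$ with $F(x+a)-cF(x)=b$; $F$ is called P$c$N if this maximum equals $1$. Then: 1. If $m$ is even, then $F$ is P$c$N for all $c\in\mathbb F_{3^m}\setminus\{1\}$ and all $\delta\in\mathbb F_{3^n}$. If $m$ is odd, then $F$ is P$c$N for all $c\in\mathbb F_{3^m}\setminus\{1\}$ and all $\delta\in\mathbb F_{3^n}$ with $\mathrm{Tr}_m^{2m}(\delta)=0$. 2. $F$ is P$c$N for all $c\in\mathbb F_{3^n}\setminus\mathbb F_{3^m}$ and all $\delta\in\mathbb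 F_{3^n}$ with $\mathrm{Tr}_m^{2m}(\delta)=0$. Moreover, $F$ has $c$-differential uniformity exactly $3$ for all $c\in\mathbb F_{3^n}\setminus\mathbb F_{3^m}$ and all $\delta\in\mathbb F_{3^n}$ with $\mathrm{Tr}_m^{2m}(\delta)\neq 0$. -/

import Mathlib

open Polynomial

/-- The entry at `(a, b)` of the `c`-difference distribution table of `F`: the number of
solutions `x` of `F (x + a) - c * F x = b`. -/
noncomputable def cDDT {K : Type*} [Field K] (F : K → K) (c a b : K) : ℕ :=
  Nat.card {x : K // F (x + a) - c * F x = b}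

/-- The set of `c`-DDT entries over which the `c`-differential uniformity is the maximum:
all pairs `(a, b)` are allowed, except that `a ≠ 0` is required when `c = 1`. -/
def cDDTEntries {K : Type*} [Field K] (F : K → K) (c : K) : Set ℕ :=
  {N | ∃ a b : K, (c = 1 → a ≠ 0) ∧ cDDT F c a b = N}

/-- The `c`-differential uniformity of `F`. Over a finite field the set of entries is finite and
nonempty, so that the supremum is a maximum; see `isGreatest_cDifferentialUniformity`. -/
noncomputable def cDifferentialUniformity {K : Type*} [Field K] (F : K → K) (c : K) : ℕ :=
  sSup (cDDTEntries F c)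

theorem isGreatest_cDifferentialUniformity {K : Type*} [Field K] [Finite K] (F : K → K) (c : K) :
    IsGreatest (cDDTEntries F c) (cDifferentialUniformity F c) := by
  have hne : (cDDTEntries F c).Nonempty :=
    ⟨_, 1, 0, fun _ => one_ne_zero, rfl⟩
  have hbdd : BddAbove (cDDTEntries F c) := by
    refine ⟨Nat.card K, ?_⟩
    rintro N ⟨a, b, -, rfl⟩
    exact Finite.card_subtype_le _
  exact ⟨Nat.sSup_mem hne hbdd, fun N hN => le_csSup hbdd hN⟩

/-- `F` is perfect `c`-nonlinear (P`c`N). -/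
def IsPcN {K : Type*} [Field K] (F : K → K) (c : K) : Prop :=
  cDifferentialUniformity F c = 1

/-- The relative trace from the field with `p ^ n` elements to the field with `p ^ m` elements,
where `m ∣ n`: the sum of the `x ^ (p ^ (m * i))` for `0 ≤ i ≤ (n - m) / m`. -/
def relTrace {K : Type*} [Field K] (p m n : ℕ) (x : K) : K :=
  ∑ i ∈ Finset.range ((n - m) / m + 1), x ^ p ^ (m * i)

/-- The polynomial `(X ^ (3 ^ m) - X + δ) ^ (3 ^ (2 * m - 1) + 2 * 3 ^ (m - 1)) + X`. -/
noncomputable def ternaryPoly {K : Type*} [Field K] (m : ℕ) (δ : K) : K[X] :=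
  (X ^ 3 ^ m - X + C δ) ^ (3 ^ (2 * m - 1) + 2 * 3 ^ (m - 1)) + X

/-! Write `σ` for x ↦ x^(3^m), an involution, T = δ + σδ and z = σx - x + δ, so that σz = T - z.
Cubing loses nothing in characteristic 3 and makes the exponent that of z(σz)², so F(x)³ = σx³ + Tz²
+ T²z + δ³. For two solutions x, x + t put s = σt - t. If T = 0, only (1 - c³)σt³ = 0 remains,
whence t = 0. In general the solution equation determines t from s; dividing it by 1 - c³ and
subtracting its `σ`-conjugate leaves s³ + As = 0, with A = T² - T(σa - a)(1/(1 - c³) - 1/(1 - σc³)).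
If σc = c, then A = T², and s ≠ 0 would make s/T a square root of -1 negated by `σ`. If σc ≠ c,
there are at most three values of s, and a suitable a attains them all. -/

section CharThree

variable {K : Type*} [Field K]

/-- The increment of `E x = F (x + a) - c * F x`, cubed, in characteristic three. -/
theorem cube_cDifference_sub (h3 : (3 : K) = 0) (σ : K →+* K) (δ : K) (F : K → K)
    (hF : ∀ x, F x ^ 3 = (σ x - x + δ) * (x - σ x + σ δ) ^ 2 + x ^ 3) (c a x t : K) :
    ((F (x + t + a) - c * F (x + t)) - (F (x + a) - c * F x)) ^ 3 =
      (1 - c ^ 3) * (σ t ^ 3 + (δ + σ δ) * ((σ t - t) ^ 2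
        - (σ x - x + δ + (δ + σ δ)) * (σ t - t)) - (δ + σ δ) ^ 2 * (σ t - t))
      - (δ + σ δ) * (σ a - a) * (σ t - t) := by
  have hcube : ∀ p q r s : K, ((p - c * q) - (r - c * s)) ^ 3 =
      p ^ 3 - c ^ 3 * q ^ 3 - r ^ 3 + c ^ 3 * s ^ 3 := by
    intro p q r s
    have hsub : ∀ y z : K, (y - z) ^ 3 = y ^ 3 - z ^ 3 := fun y z => by
      linear_combination (y * z ^ 2 - y ^ 2 * z) * h3
    rw [hsub, hsub, hsub]
    ring
  rw [hcube, hF, hF, hF, hF]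
  simp only [map_add]
  generalize σ x = X, σ t = t', σ a = A, σ δ = D
  -- In the coordinates s, α = σa - a, z and T the two sides agree modulo 3.
  obtain ⟨s, rfl⟩ : ∃ s, t' = s + t := ⟨t' - t, by ring⟩
  obtain ⟨α, rfl⟩ : ∃ α, A = α + a := ⟨A - a, by ring⟩
  obtain ⟨z, rfl⟩ : ∃ z, X = z + x - δ := ⟨X - x + δ, by ring⟩
  obtain ⟨T, rfl⟩ : ∃ T, D = T - δ := ⟨D + δ, by ring⟩
  linear_combination ((z + α) ^ 2 * s + (z + α) * s ^ 2 - T * (z + α) * s - T * s ^ 2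
    - c ^ 3 * (z ^ 2 * s + z * s ^ 2 - T * z * s - T * s ^ 2)
    + (x + a) ^ 2 * t + (x + a) * t ^ 2 - c ^ 3 * (x ^ 2 * t + x * t ^ 2)
    + (1 - c ^ 3) * (T ^ 2 * s - s ^ 2 * t - s * t ^ 2)) * h3

theorem cube_injective_of_three_eq_zero (h3 : (3 : K) = 0) {x y : K} (h : x ^ 3 = y ^ 3) :
    x = y := by
  have : (x - y) ^ 3 = 0 := by
    linear_combination h + (x * y ^ 2 - x ^ 2 * y) * h3
  exact sub_eq_zero.mp (pow_eq_zero_iff (by norm_num) |>.mp this)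

theorem one_sub_cube_ne_zero (h3 : (3 : K) = 0) {c : K} (hc : c ≠ 1) : 1 - c ^ 3 ≠ 0 := by
  intro h
  exact hc (cube_injective_of_three_eq_zero h3 (by linear_combination -h))

theorem isPcN_of_injective [Finite K] {F : K → K} {c : K}
    (h : ∀ a x y : K, F (x + a) - c * F x = F (y + a) - c * F y → x = y) : IsPcN F c := by
  apply (isGreatest_cDifferentialUniformity F c).unique
  have hle : ∀ a b, cDDT F c a b ≤ 1 := by
    intro a b
    have : Subsingleton {x : K // F (x + a) - c * F x = b} :=
      ⟨fun x y => Subtype.ext (h a _ _ (x.2.trans y.2.symm))⟩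
    exact Finite.card_le_one_iff_subsingleton.mpr this
  refine ⟨⟨1, F (0 + 1) - c * F 0, fun _ => one_ne_zero, le_antisymm (hle _ _) ?_⟩, ?_⟩
  · have : Nonempty {x : K // F (x + 1) - c * F x = F (0 + 1) - c * F 0} := ⟨⟨0, rfl⟩⟩
    exact Finite.card_pos
  · rintro N ⟨a, b, -, rfl⟩
    exact hle a b

theorem card_le_three_of_cubic (A : K) {S : Type*} (f : S → K)
    (hf : Function.Injective f) (h : ∀ x, f x ^ 3 + A * f x = 0) : Nat.card S ≤ 3 := by
  classical
  set p : K[X] := X ^ 3 + C A * X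
  have hdeg : p.natDegree = 3 := by simp only [p]; compute_degree!
  have hp : p ≠ 0 := fun h0 => by simp [h0] at hdeg
  let g : S → p.roots.toFinset := fun x => ⟨f x, by
    simp only [Multiset.mem_toFinset, mem_roots hp, IsRoot.def, p]
    simpa using h x⟩
  have hg : Function.Injective g := fun x y hxy => hf (congrArg Subtype.val hxy)
  calc Nat.card S ≤ Nat.card p.roots.toFinset := Nat.card_le_card_of_injective g hg
    _ = p.roots.toFinset.card := Nat.card_eq_finsetCard _
    _ ≤ p.roots.card := Multiset.toFinset_card_le _
    _ ≤ 3 := hdeg ▸ p.card_roots'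

theorem isPcN_of_trace_eq_zero [Finite K] (h3 : (3 : K) = 0) (σ : K →+* K)
    (hσ : ∀ x, σ (σ x) = x) (δ : K) (F : K → K)
    (hF : ∀ x, F x ^ 3 = (σ x - x + δ) * (x - σ x + σ δ) ^ 2 + x ^ 3) {c : K} (hc : c ≠ 1)
    (hT : δ + σ δ = 0) : IsPcN F c := by
  apply isPcN_of_injective
  intro a x y hxy
  have key := cube_cDifference_sub h3 σ δ F hF c a x (y - x)
  rw [add_sub_cancel, ← hxy, sub_self, hT] at key
  have h : σ (y - x) = 0 := by
    simpa [one_sub_cube_ne_zero h3 hc] using key.symm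
  have := hσ (y - x)
  rw [h, map_zero] at this
  exact (sub_eq_zero.mp this.symm).symm

theorem isPcN_of_fixed [Finite K] (h3 : (3 : K) = 0) (σ : K →+* K)
    (hσ : ∀ x, σ (σ x) = x) (δ : K) (F : K → K)
    (hF : ∀ x, F x ^ 3 = (σ x - x + δ) * (x - σ x + σ δ) ^ 2 + x ^ 3) {c : K} (hc : c ≠ 1)
    (hcσ : σ c = c) (hi : ∀ r : K, r ^ 2 = -1 → σ r = r) : IsPcN F c := by
  by_cases hT : δ + σ δ = 0
  · exact isPcN_of_trace_eq_zero h3 σ hσ δ F hF hc hT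
  apply isPcN_of_injective
  intro a x y hxy
  have key := cube_cDifference_sub h3 σ δ F hF c a x (y - x)
  rw [add_sub_cancel, ← hxy, sub_self] at key
  have hy : y = x + (y - x) := by ring
  generalize y - x = t at key hy
  have hC := one_sub_cube_ne_zero h3 hc
  have keyσ := congrArg σ key
  simp only [map_sub, map_add, map_mul, map_pow, hσ, hcσ, map_one, map_zero, zero_pow three_ne_zero]
    at keyσ key
  set s := σ t - t with hs
  have hσs : σ s = -s := by simp [hs, hσ]
  -- The conjugate equation minus the original: since `σ` fixes c, the terms in a cancel.
  have hmul : (1 - c ^ 3) * (s * (s ^ 2 + (δ + σ δ) ^ 2)) = 0 := by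
    linear_combination (keyσ - key) + (1 - c ^ 3) * (2 * (δ + σ δ) ^ 2 * s
      - s ^ 2 * t - s * t ^ 2) * h3
  have hs0 : s = 0 := by
    rcases mul_eq_zero.mp ((mul_eq_zero.mp hmul).resolve_left hC) with h | h
    · exact h
    · have hr : (s / (δ + σ δ)) ^ 2 = -1 := by
        field_simp
        linear_combination h
      have hr' := hi _ hr
      rw [map_div₀, hσs, map_add, hσ, add_comm (σ δ) δ] at hr'
      have : -s = s := by
        field_simp at hr'
        exact hr'
      linear_combination s * h3 + this
  have hts : σ t = t := sub_eq_zero.mp (hs ▸ hs0)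
  rw [hs0] at key
  have : t = 0 := by
    simpa [hC, hts] using key.symm
  rw [hy, this, add_zero]

theorem cDifferentialUniformity_eq_three [Finite K] (h3 : (3 : K) = 0) (σ : K →+* K)
    (hσ : ∀ x, σ (σ x) = x) (hcbrt : ∀ x : K, ∃ y, y ^ 3 = x) (δ : K) (F : K → K)
    (hF : ∀ x, F x ^ 3 = (σ x - x + δ) * (x - σ x + σ δ) ^ 2 + x ^ 3) {c : K}
    (hcσ : σ c ≠ c) (hT : δ + σ δ ≠ 0) : cDifferentialUniformity F c = 3 := by
  have hc : c ≠ 1 := fun h => hcσ (by rw [h, map_one])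
  have hC := one_sub_cube_ne_zero h3 hc
  have hσc : σ c ≠ 1 := fun h => hc (by rw [← hσ c, h, map_one])
  have hC' := one_sub_cube_ne_zero h3 hσc
  have hσT : σ (δ + σ δ) = δ + σ δ := by rw [map_add, hσ, add_comm]
  have hle : ∀ a b, cDDT F c a b ≤ 3 := by
    intro a b
    rcases isEmpty_or_nonempty {x : K // F (x + a) - c * F x = b} with _ | ⟨x, hx⟩
    · simp [cDDT]
    have eqn : ∀ y : {x : K // F (x + a) - c * F x = b},
        (1 - c ^ 3) * (σ (y - x) ^ 3 + (δ + σ δ) * ((σ (y - x) - (y - x)) ^ 2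
        - (σ x - x + δ + (δ + σ δ)) * (σ (y - x) - (y - x)))
          - (δ + σ δ) ^ 2 * (σ (y - x) - (y - x)))
        - (δ + σ δ) * (σ a - a) * (σ (y - x) - (y - x)) = 0 := by
      intro y
      rw [← cube_cDifference_sub h3 σ δ F hF c a x (y - x), add_sub_cancel, y.2, hx, sub_self,
        zero_pow three_ne_zero]
    refine card_le_three_of_cubic ((δ + σ δ) ^ 2 -
      (δ + σ δ) * (σ a - a) * (1 / (1 - c ^ 3) - 1 / (1 - σ c ^ 3)))
      (fun y => σ (y - x) - (y - x)) ?_ ?_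
    -- Equal s forces equal σt³, hence equal t.
    · intro y z hyz
      have h1 := eqn y
      have h2 := eqn z
      simp only at hyz
      rw [hyz] at h1
      have h : σ (y - x) ^ 3 = σ (z - x) ^ 3 := by
        apply mul_left_cancel₀ hC
        linear_combination h1 - h2
      have h' := σ.injective (cube_injective_of_three_eq_zero h3 h)
      exact Subtype.ext (sub_left_inj.mp h')
    · intro y
      have key := eqn y
      generalize (y : K) - x = t at key
      have keyσ := congrArg σ key
      simp only [map_sub, map_add, map_mul, map_pow, hσ, map_one, map_zero] at keyσ
      field_simp
      linear_combination (1 - σ c ^ 3) * key - (1 - c ^ 3) * keyσ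
        + 2 * (1 - c ^ 3) * (1 - σ c ^ 3) * (δ + σ δ) ^ 2 * (σ t - t) * h3
        + (1 - c ^ 3) * (1 - σ c ^ 3) * (σ t * t ^ 2 - σ t ^ 2 * t) * h3
  apply (isGreatest_cDifferentialUniformity F c).unique
  refine ⟨?_, by rintro N ⟨a, b, -, rfl⟩; exact hle a b⟩
  set T := δ + σ δ with hTdef
  set s := σ c - c with hs
  have hs0 : s ≠ 0 := sub_ne_zero.mpr hcσ
  have hσs : σ s = -s := by simp [hs, hσ]
  have hCC : c ^ 3 - σ c ^ 3 ≠ 0 := fun h =>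
    hcσ (cube_injective_of_three_eq_zero h3 (sub_eq_zero.mp h)).symm
  -- Chosen so that σa - a = -2a = a and A = -s²: the cubic then splits with roots 0, s, -s.
  set a := (T ^ 2 + s ^ 2) * ((1 - c ^ 3) * (1 - σ c ^ 3)) / (T * (c ^ 3 - σ c ^ 3)) with ha
  have hσa : σ a = -a := by
    have hCC' : σ c ^ 3 - c ^ 3 ≠ 0 := fun h => hCC (by linear_combination -h)
    simp only [ha, map_div₀, map_mul, map_add, map_sub, map_pow, map_one, hσ, hσs, hσT]
    field_simp
    ring
  have hsol : ∀ r : K, σ r = -r → r ^ 2 = s ^ 2 → ∃ t : K, σ t - t = r ∧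
      F (t + a) - c * F t = F (0 + a) - c * F 0 := by
    intro r hσr hr
    -- Here v plays σt: the equation at x = 0 with σt - t = r prescribes its cube. Consistency, v -
    -- σv = r, is the cubic for r.
    obtain ⟨v, hv⟩ := hcbrt (-(T * (r ^ 2 - (δ + T) * r) - T ^ 2 * r
      - T * a * r / (1 - c ^ 3)))
    have hσv := congrArg σ hv
    simp only [map_neg, map_sub, map_mul, map_add, map_pow, map_div₀, map_one, hσr, hσa, hσT]
      at hσv
    have hvr : v - σ v = r := by
      apply cube_injective_of_three_eq_zero h3
      have hB : T * a * (c ^ 3 - σ c ^ 3) = (T ^ 2 + r ^ 2) * ((1 - c ^ 3) * (1 - σ c ^ 3)) := by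
        rw [ha, hr]
        field_simp
      have h1 : T * a / (1 - c ^ 3) - T * a / (1 - σ c ^ 3) = T ^ 2 + r ^ 2 := by
        field_simp
        linear_combination hB
      have hδ : σ δ = T - δ := by rw [hTdef]; ring
      rw [hδ] at hσv
      linear_combination hv - hσv + r * h1 + (v * σ v ^ 2 - v ^ 2 * σ v + 2 * T ^ 2 * r) * h3
    refine ⟨σ v, by rw [hσ, hvr], ?_⟩
    rw [← sub_eq_zero]
    have key := cube_cDifference_sub h3 σ δ F hF c a 0 (σ v)
    rw [hσ, hvr, hv, hσa, map_zero, ← hTdef, zero_add (σ v)] at key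
    apply pow_eq_zero_iff three_ne_zero |>.mp
    rw [key]
    field_simp
    linear_combination T * a * r * h3
  obtain ⟨t₁, ht₁, he₁⟩ := hsol s hσs rfl
  obtain ⟨t₂, ht₂, he₂⟩ := hsol (-s) (by rw [map_neg, hσs]) (by ring)
  refine ⟨a, F (0 + a) - c * F 0, fun h => absurd h hc, le_antisymm (hle _ _) ?_⟩
  have hss : s ≠ -s := fun h => hs0 (by linear_combination s * h3 - h)
  have h01 : (0 : K) ≠ t₁ := fun h => hs0 (by rw [← ht₁, ← h]; simp)
  have h02 : (0 : K) ≠ t₂ := fun h => hs0 (by rw [← neg_eq_zero, ← ht₂, ← h]; simp)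
  have h12 : t₁ ≠ t₂ := fun h => hss (by rw [← ht₂, ← ht₁, h])
  classical
  calc 3 = ({0, t₁, t₂} : Finset K).card := (Finset.card_eq_three.mpr
        ⟨0, t₁, t₂, h01, h02, h12, rfl⟩).symm
    _ = Nat.card ({0, t₁, t₂} : Finset K) := (Nat.card_eq_finsetCard _).symm
    _ ≤ cDDT F c a (F (0 + a) - c * F 0) := by
      refine Nat.card_le_card_of_injective (fun x => ⟨x.1, ?_⟩)
        (fun x y h => Subtype.ext (Subtype.mk.inj h))
      have hx := x.2
      simp only [Finset.mem_insert, Finset.mem_singleton] at hx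
      rcases hx with h | h | h <;> rw [h]
      · exact he₁
      · exact he₂

end CharThree

/-! ### Finite subfields and the Frobenius involution -/

theorem Subfield.mem_iff_pow_card_eq {K : Type*} [Field K] (k : Subfield K) [Finite k] (x : K) :
    x ∈ k ↔ x ^ Nat.card k = x := by
  classical
  have := Fintype.ofFinite k
  rw [Nat.card_eq_fintype_card]
  constructor
  · intro hx
    exact congrArg Subtype.val (FiniteField.pow_card (⟨x, hx⟩ : k))
  · intro hx
    have hq : 1 < Fintype.card k := Fintype.one_lt_card
    have hp := FiniteField.X_pow_card_sub_X_ne_zero K hq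
    have hdeg := FiniteField.X_pow_card_sub_X_natDegree_eq K hq
    set p : K[X] := X ^ Fintype.card k - X
    let S : Finset K := Finset.univ.map (Function.Embedding.subtype (· ∈ k))
    have hS : S ⊆ p.roots.toFinset := by
      intro y hy
      obtain ⟨z, -, rfl⟩ := Finset.mem_map.mp hy
      have hz := congrArg Subtype.val (FiniteField.pow_card z)
      simp only [Multiset.mem_toFinset, mem_roots hp, IsRoot.def, p]
      simpa [sub_eq_zero] using hz
    have hcard : p.roots.toFinset.card ≤ S.card :=
      ((Multiset.toFinset_card_le _).trans p.card_roots').trans (by simp [hdeg, S])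
    have hmem : x ∈ S := by
      rw [Finset.eq_of_subset_of_card_le hS hcard]
      simp only [Multiset.mem_toFinset, mem_roots hp, IsRoot.def, p]
      simp [hx]
    obtain ⟨z, -, rfl⟩ := Finset.mem_map.mp hmem
    exact z.2

theorem theorem4p1 {K : Type*} [Field K] [Finite K] (m n : ℕ) (hm : 0 < m) (hn : n = 2 * m)
    (hK : Nat.card K = 3 ^ n) (k : Subfield K) (hk : Nat.card k = 3 ^ m) :
    (∀ c ∈ k, c ≠ 1 → ∀ δ : K, (Even m ∨ relTrace 3 m n δ = 0) →
      IsPcN (fun x : K => (ternaryPoly m δ).eval x) c) ∧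
    (∀ c ∉ k, ∀ δ : K, relTrace 3 m n δ = 0 →
      IsPcN (fun x : K => (ternaryPoly m δ).eval x) c) ∧
    (∀ c ∉ k, ∀ δ : K, relTrace 3 m n δ ≠ 0 →
      cDifferentialUniformity (fun x : K => (ternaryPoly m δ).eval x) c = 3) := by
  subst hn
  have := Fintype.ofFinite K
  have hchar : CharP K 3 := charP_of_card_eq_prime_pow (f := 2 * m)
    (by rw [← Nat.card_eq_fintype_card, hK])
  have h3 : (3 : K) = 0 := by exact_mod_cast CharP.cast_eq_zero K 3
  let σ : K →+* K := iterateFrobenius K 3 m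
  have hσdef : ∀ x, σ x = x ^ 3 ^ m := fun x => iterateFrobenius_def 3 m x
  have hσ : ∀ x, σ (σ x) = x := by
    intro x
    rw [hσdef, hσdef, ← pow_mul, ← pow_add, ← two_mul, ← hK, Nat.card_eq_fintype_card,
      FiniteField.pow_card]
  have hmem : ∀ c : K, c ∈ k ↔ σ c = c := by
    intro c
    rw [k.mem_iff_pow_card_eq, hk, hσdef]
  have hcbrt : ∀ x : K, ∃ y, y ^ 3 = x := fun x =>
    (bijective_frobenius K 3).surjective x
  have htr : ∀ δ : K, relTrace 3 m (2 * m) δ = δ + σ δ := by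
    intro δ
    have : (2 * m - m) / m + 1 = 2 := by
      rw [two_mul, Nat.add_sub_cancel, Nat.div_self hm]
    simp [relTrace, this, Finset.sum_range_succ, hσdef]
  have hF : ∀ δ x : K, (ternaryPoly m δ).eval x ^ 3 =
      (σ x - x + δ) * (x - σ x + σ δ) ^ 2 + x ^ 3 := by
    intro δ x
    have hz : x - σ x + σ δ = σ (σ x - x + δ) := by rw [map_add, map_sub, hσ]
    -- Positivity of m keeps both truncated subtractions exact.
    have hexp : (3 ^ (2 * m - 1) + 2 * 3 ^ (m - 1)) * 3 = 3 ^ m * 3 ^ m + 3 ^ m * 2 := by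
      obtain ⟨j, rfl⟩ := Nat.exists_eq_add_of_lt hm
      have : 2 * (0 + j + 1) - 1 = j + j + 1 := by omega
      rw [this, Nat.zero_add, Nat.add_sub_cancel]
      ring
    have hcube : ∀ y z : K, (y + z) ^ 3 = y ^ 3 + z ^ 3 := fun y z => add_pow_char y z 3
    rw [hz]
    simp only [ternaryPoly, eval_add, eval_pow, eval_sub, eval_X, eval_C]
    rw [hcube, ← pow_mul, hexp, pow_add, pow_mul, pow_mul, ← hσdef, ← hσdef, ← hσdef, hσ]
  refine ⟨?_, ?_, ?_⟩
  · rintro c hc hc1 δ (hm2 | hT)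
    · refine isPcN_of_fixed h3 σ hσ δ _ (hF δ) hc1 ((hmem c).mp hc) ?_
      intro r hr
      obtain ⟨j, rfl⟩ := hm2
      -- A square root of -1 lies in the field of 9 elements, which is fixed by `σ` for even m.
      have h9 : r ^ 9 = r := by
        linear_combination r * (r ^ 6 - r ^ 4 + r ^ 2 - 1) * hr
      have h9j : ∀ i : ℕ, r ^ 9 ^ i = r := by
        intro i
        induction i with
        | zero => simp
        | succ i ih => rw [pow_succ, pow_mul, ih, h9]
      have hpow : 3 ^ (j + j) = 9 ^ j := by rw [← two_mul, pow_mul]; norm_num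
      rw [hσdef, hpow, h9j]
    · rw [htr] at hT
      exact isPcN_of_trace_eq_zero h3 σ hσ δ _ (hF δ) hc1 hT
  · intro c hc δ hT
    rw [htr] at hT
    exact isPcN_of_trace_eq_zero h3 σ hσ δ _ (hF δ) (fun h => hc (h ▸ k.one_mem)) hT
  · intro c hc δ hT
    rw [htr] at hT
    exact cDifferentialUniformity_eq_three h3 σ hσ hcbrt δ _ (hF δ)
      (fun h => hc ((hmem c).mpr h)) hT
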